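/- Let $m,n\ge 0$ be integers, let $a_1,\dots,a_m\in\mathbb C$ be distinct points lying in this order on a smooth simple closed positively oriented curve $\Gamma\subset\mathbb C$, let $\rho:\tilde S\to S$ be the universal covering of $S=(\mathbb C\cup\{\infty\})\setminus\{a_1,\dots,a_m\}$, and let $\Delta$ be its group of deck transformations. Fix $\tilde z_0\in\tilde S$ with $\rho(\tilde z_0)$ inside $\Gamma$, and let $\sigma_k\in\Delta$ be the deck transformation that sends $\tilde z_0$ to the end point of the lift, starting at $\tilde z_0$, of a loop in $S$ at $\rho(\tilde z_0)$ which leaves the inside of $\Gamma$ through the open subarc of $\Gamma$ from $a_{k-1}$ to $a_k$, returns through the open subarc from $a_k$ to $a_{k+1}$ (indices modulo $m$), and meets $\Gamma$ nowhere else. For a system $Y'=A(z)Y$, with $A$ an analytic $n\times n$ matrix function on $\mathbb C\setminus\{a_1,\dots,a_m\}$, a solution means an invertible matrix solution. If $Y$ is a solution on $\tilde S\setminus\rho^{-1}(\infty)$, its monodromy representation $\chi:\Delta\to GL_n(\mathbb C)$ is defined by $Y(\tilde z)=Y(\sigma(\tilde z))\chi(\sigma)$. The monodromy of the system is called irreducible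 if the matrices $\chi(\sigma)$, $\sigma\in\Delta$, have no common invariant subspace other than $\{0\}$ and $\mathbb C^n$, for some (equivalently, each) such $\chi$. Let $\varkappa_1\ge\dots\ge\varkappa_n$ be integers. The system is of standard form with singularities $a_1,\dots,a_m$ and indices $\varkappa_1,\dots,\varkappa_n$ if there are $n\times n$ matrices $M_1,\dots,M_m$, $E_1,\dots,E_m$ with $M_1\cdots M_m=I$, with $M_k$ similar to $\exp(-2\pi iE_k)$, and with each $E_k$ non-resonant (no two eigenvalues of $E_k$ differ by a nonzero integer), such that: (i) $A$ is analytic on $\mathbb C\setminus\{a_1,\dots,a_m\}$ and the singularity at infinity is apparent, i.e. solutions have no branching there; (ii) for a monodromy representation $\chi$ of the system there is $C\in GL_n(\mathbb C)$ with $M_k=C^{-1}\chi(\sigma_k)C$ for $k=1,\dots,m$; (iii) for each $k$, the solutions on the universal covering of a small punctured disk around $a_k$ have the form $Y(\tilde z)=Z_k(z)(\tilde z-a_k)^{E_k}C$, where $Z_k$ is analytic and invertible on the full disk and $C\in GL_n(\mathbb C)$; (iv) the solutions on a punctured neighbourhood of infinity have the form $Y(z)=\mathrm{diag}(z^{\varkappa_1},\dots,z^{\varkappa_n})\,Z_\infty(z)\,C$,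 where $Z_\infty$ is analytic and invertible near and at infinity and $C\in GL_n(\mathbb C)$. Theorem. If $Y'=A(z)Y$ is a system of standard form with singularities $a_1,\dots,a_m$ and indices $\varkappa_1\ge\dots\ge\varkappa_n$, and its monodromy is irreducible, then $$\varkappa_k-\varkappa_{k+1}\le m-2\qquad\text{for each } k=1,\dots,n-1.$$ -/

import Mathlib

namespace StandardForm

/-- `n × n` complex matrices. -/
abbrev Mat (n : ℕ) : Type := Matrix (Fin n) (Fin n) ℂ

/-! ### Linear systems on open subsets of the plane -/

/-- `Y` is an (invertible matrix) solution of `Y' = A Y` on the open set `U ⊆ ℂ`. -/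
def SolvesOn {n : ℕ} (A : ℂ → Mat n) (U : Set ℂ) (Y : ℂ → Mat n) : Prop :=
  ∀ z ∈ U, IsUnit (Y z) ∧ ∀ i j, HasDerivAt (fun ζ => Y ζ i j) ((A z * Y z) i j) z

/-- A matrix function that is analytic on `U`, entry by entry. -/
def MatAnalyticOn {n : ℕ} (A : ℂ → Mat n) (U : Set ℂ) : Prop :=
  ∀ i j, AnalyticOnNhd ℂ (fun z => A z i j) U

/-- An analytic function `U → GL_n(ℂ)`. -/
def InvAnalyticOn {n : ℕ} (Z : ℂ → Mat n) (U : Set ℂ) : Prop :=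
  MatAnalyticOn Z U ∧ ∀ z ∈ U, IsUnit (Z z)

/-- The universal covering of the punctured disk `0 < |z - a| < ε`, in the coordinate
`w = log (z - a)`: the covering map is `w ↦ a + exp w` on this half plane. -/
def logHalfPlane (ε : ℝ) : Set ℂ := {w | w.re < Real.log ε}

/-- The coefficient matrix of the system `Y' = A Y` pulled back along `w ↦ a + exp w`. -/
noncomputable def logPullback {n : ℕ} (A : ℂ → Mat n) (a : ℂ) (w : ℂ) : Mat n :=
  Complex.exp w • A (a + Complex.exp w)

/-- On the universal covering of a small punctured disk around `a`, the solutions of `Y' = A Y`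
are the functions `Z(z) (z - a) ^ E C` with `C` constant and invertible, where `Z` is analytic and
invertible on the full disk and `(z - a) ^ E = exp (E log (z - a))`. -/
def HasLocalForm {n : ℕ} (A : ℂ → Mat n) (a : ℂ) (E : Mat n) : Prop :=
  ∃ ε : ℝ, 0 < ε ∧ ∃ Z : ℂ → Mat n, InvAnalyticOn Z (Metric.ball a ε) ∧
    ∀ Y : ℂ → Mat n, SolvesOn (logPullback A a) (logHalfPlane ε) Y ↔
      ∃ C : GL (Fin n) ℂ, ∀ w ∈ logHalfPlane ε,
        Y w = Z (a + Complex.exp w) * NormedSpace.exp (w • E) * (C : Mat n)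

/-- The punctured neighbourhood `|z| > 1 / ε` of infinity. -/
def nhdInfty (ε : ℝ) : Set ℂ := {z | ε⁻¹ < ‖z‖}

/-- The singularity of `Y' = A Y` at infinity is apparent: the solutions have no branching at
infinity, i.e. there are single-valued ones on a punctured neighbourhood of infinity. -/
def ApparentAtInfty {n : ℕ} (A : ℂ → Mat n) : Prop :=
  ∃ ε : ℝ, 0 < ε ∧ ∃ Y : ℂ → Mat n, SolvesOn A (nhdInfty ε) Y

/-- On a punctured neighbourhood of infinity, the solutions of `Y' = A Y` are the functions
`diag (z ^ κ₁, …, z ^ κₙ) Z(z) C` with `C` constant and invertible, where `Z` is analytic and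
invertible at infinity as well (so that `Z(z) = W(1 / z)` with `W` analytic and invertible on a
full disk around `0`). -/
def HasFormAtInfty {n : ℕ} (A : ℂ → Mat n) (κ : Fin n → ℤ) : Prop :=
  ∃ ε : ℝ, 0 < ε ∧ ∃ W : ℂ → Mat n, InvAnalyticOn W (Metric.ball 0 ε) ∧
    ∀ Y : ℂ → Mat n, SolvesOn A (nhdInfty ε) Y ↔
      ∃ C : GL (Fin n) ℂ, ∀ z ∈ nhdInfty ε,
        Y z = Matrix.diagonal (fun i => z ^ κ i) * W z⁻¹ * (C : Mat n)

/-! ### Admissible data -/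

/-- The difference of any two eigenvalues of `E` is not a nonzero integer. -/
def NonResonant {n : ℕ} (E : Mat n) : Prop :=
  ∀ μ ∈ spectrum ℂ E, ∀ ν ∈ spectrum ℂ E, ∀ l : ℤ, μ - ν = l → l = 0

/-- Admissible data `[M₁, …, Mₘ]`, `[E₁, …, Eₘ]`; `IsConj` is similarity of matrices. -/
structure AdmissibleData {m n : ℕ} (M E : Fin m → Mat n) : Prop where
  prod_eq_one : (List.ofFn M).prod = 1
  similar : ∀ k, IsConj (M k) (NormedSpace.exp ((-(2 * Real.pi * Complex.I : ℂ)) • E k))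
  nonResonant : ∀ k, NonResonant (E k)

/-! ### The punctured sphere, its universal covering, and monodromy -/

/-- `S`, the Riemann sphere (with the point at infinity) without the points `a₁, …, aₘ`. -/
def PuncturedSphere {m : ℕ} (a : Fin m → ℂ) : Type :=
  {p : OnePoint ℂ // ∀ k, p ≠ (a k : OnePoint ℂ)}

instance {m : ℕ} (a : Fin m → ℂ) : TopologicalSpace (PuncturedSphere a) :=
  inferInstanceAs (TopologicalSpace {p : OnePoint ℂ // ∀ k, p ≠ (a k : OnePoint ℂ)})

/-- `ρ : X → S` is a universal covering of the punctured sphere. -/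
structure IsUniversalCovering {m : ℕ} {a : Fin m → ℂ} {X : Type*} [TopologicalSpace X]
    (ρ : X → PuncturedSphere a) : Prop where
  simplyConnected : SimplyConnectedSpace X
  covering : IsCoveringMap ρ
  surjective : Function.Surjective ρ

section Cover

variable {m n : ℕ} {a : Fin m → ℂ} {X : Type*} [TopologicalSpace X]

/-- The group of deck transformations, with composition as multiplication. -/
def Deck (ρ : X → PuncturedSphere a) : Subgroup (X ≃ₜ X) where
  carrier := {σ | ∀ x, ρ (σ x) = ρ x}
  one_mem' := fun _ => rfl
  mul_mem' := fun {σ τ} hσ hτ x => (hσ (τ x)).trans (hτ x)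
  inv_mem' := fun {σ} hσ x => by
    have h := hσ (σ⁻¹ x)
    have e : σ (σ⁻¹ x) = x := σ.apply_symm_apply x
    rw [e] at h
    exact h.symm

/-- `Y` is an invertible matrix solution of `Y' = A(z) Y` on the universal covering without the
points above infinity (its values at those points play no role): near every point above
`z ∈ ℂ` one has `Y = F ∘ ρ`, where `F` solves the system near `z`. -/
def SolvesOnCover (ρ : X → PuncturedSphere a) (A : ℂ → Mat n) (Y : X → Mat n) : Prop :=
  ∀ (x : X) (z : ℂ), (ρ x).1 = (z : OnePoint ℂ) →
    ∃ U : Set ℂ, IsOpen U ∧ z ∈ U ∧ ∃ F : ℂ → Mat n, SolvesOn A U F ∧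
      ∀ᶠ x' in nhds x, ∀ z' : ℂ, (ρ x').1 = (z' : OnePoint ℂ) → Y x' = F z'

/-- `χ` is the monodromy representation of some solution `Y` of the system:
`Y(x) = Y(σ x) χ(σ)` for all deck transformations `σ`. -/
def IsMonodromyRep (ρ : X → PuncturedSphere a) (A : ℂ → Mat n)
    (χ : Deck ρ →* GL (Fin n) ℂ) : Prop :=
  ∃ Y : X → Mat n, SolvesOnCover ρ A Y ∧
    ∀ (σ : Deck ρ) (x : X), (ρ x).1 ≠ OnePoint.infty →
      Y x = Y ((σ : X ≃ₜ X) x) * (χ σ : Mat n)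

/-- A collection of matrices is irreducible if it has no invariant subspace except `0` and `ℂⁿ`. -/
def IrreducibleFamily {Ω : Type*} (M : Ω → Mat n) : Prop :=
  ∀ V : Submodule ℂ (Fin n → ℂ), (∀ ω, ∀ v ∈ V, (M ω).mulVec v ∈ V) → V = ⊥ ∨ V = ⊤

/-- The monodromy of the system is irreducible. (All monodromy representations of the system are
conjugate to each other, so irreducibility does not depend on the choice of `χ`.) -/
def IrreducibleMonodromy (ρ : X → PuncturedSphere a) (A : ℂ → Mat n) : Prop :=
  ∃ χ : Deck ρ →* GL (Fin n) ℂ, IsMonodromyRep ρ A χ ∧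
    IrreducibleFamily (fun σ => (χ σ : Mat n))

end Cover

/-! ### The curve and the standard generators of the deck group -/

/-- The points of the plane enclosed by the closed curve `Γ`. -/
def inside (Γ : ℝ → ℂ) : Set ℂ :=
  {z | z ∉ Set.range Γ ∧ Bornology.IsBounded (connectedComponentIn (Set.range Γ)ᶜ z)}

/-- The part of the sphere outside `Γ`, including infinity. -/
def outside (Γ : ℝ → ℂ) : Set (OnePoint ℂ) :=
  {p | ∀ z : ℂ, p = (z : OnePoint ℂ) → z ∉ Set.range Γ ∧ z ∉ inside Γ}

/-- `Γ` is a smooth simple closed positively oriented curve in the plane, parametrized with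
period `1`, and `aₖ = Γ(tₖ)` lie on it in this order. -/
structure IsCurveThrough {m : ℕ} (a : Fin m → ℂ) (Γ : ℝ → ℂ) (t : Fin m → ℝ) : Prop where
  periodic : Function.Periodic Γ 1
  simple : Set.InjOn Γ (Set.Ico 0 1)
  smooth : ContDiff ℝ 1 Γ
  regular : ∀ s, deriv Γ s ≠ 0
  positive : ∀ z ∈ inside Γ,
    ∫ s in (0 : ℝ)..1, deriv Γ s / (Γ s - z) = 2 * Real.pi * Complex.I
  on_curve : ∀ k, Γ (t k) = a k
  ordered : StrictMono t
  one_turn : ∀ j k, t j < t k + 1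

/-- The open subarc of `Γ` that joins the preceding marked point to `aₖ`. -/
def arcBefore {m : ℕ} (a : Fin m → ℂ) (Γ : ℝ → ℂ) (t : Fin m → ℝ) (k : Fin m) : Set ℂ :=
  {z | ∃ u < t k, z = Γ u ∧ ∀ s ∈ Set.Ico u (t k), ∀ j, Γ s ≠ a j}

/-- The open subarc of `Γ` that joins `aₖ` to the following marked point. -/
def arcAfter {m : ℕ} (a : Fin m → ℂ) (Γ : ℝ → ℂ) (t : Fin m → ℝ) (k : Fin m) : Set ℂ :=
  {z | ∃ v > t k, z = Γ v ∧ ∀ s ∈ Set.Ioc (t k) v, ∀ j, Γ s ≠ a j}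

/-- `σ₁, …, σₘ` are the standard deck transformations with base point `x₀` above a point inside
`Γ`: from `x₀` to `σₖ x₀` there is a path in the covering surface whose projection leaves the
inside of `Γ` through the open subarc before `aₖ` and returns through the open subarc after `aₖ`,
without meeting `Γ` in between, before or afterwards. -/
def IsStandardDeck {m : ℕ} {a : Fin m → ℂ} {X : Type*} [TopologicalSpace X]
    (ρ : X → PuncturedSphere a) (Γ : ℝ → ℂ) (t : Fin m → ℝ) (x₀ : X)
    (σ : Fin m → Deck ρ) : Prop :=
  (∃ z ∈ inside Γ, (ρ x₀).1 = (z : OnePoint ℂ)) ∧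
  ∀ k, ∃ γ : Path x₀ ((σ k : X ≃ₜ X) x₀), ∃ s₁ s₂ : unitInterval, s₁ < s₂ ∧
    (∃ z ∈ arcBefore a Γ t k, (ρ (γ s₁)).1 = (z : OnePoint ℂ)) ∧
    (∃ z ∈ arcAfter a Γ t k, (ρ (γ s₂)).1 = (z : OnePoint ℂ)) ∧
    (∀ s, s < s₁ ∨ s₂ < s → ∃ z ∈ inside Γ, (ρ (γ s)).1 = (z : OnePoint ℂ)) ∧
    (∀ s, s₁ < s → s < s₂ → (ρ (γ s)).1 ∈ outside Γ)

/-! ### Systems of standard form -/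

/-- The system `Y' = A(z) Y` is of standard form with respect to the data `M`, `E`, with
singularities `a₁, …, aₘ` and with (decreasingly ordered) indices `κ₁ ≥ … ≥ κₙ`; the monodromy is
expressed through the deck transformations `σ₁, …, σₘ` of the universal covering `ρ`. -/
structure IsStandardForm {m n : ℕ} {a : Fin m → ℂ} {X : Type*} [TopologicalSpace X]
    (ρ : X → PuncturedSphere a) (σ : Fin m → Deck ρ) (A : ℂ → Mat n)
    (M E : Fin m → Mat n) (κ : Fin n → ℤ) : Prop where
  admissible : AdmissibleData M E
  ordered : Antitone κ
  analytic : MatAnalyticOn A (Set.range a)ᶜ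
  apparent : ApparentAtInfty A
  monodromy : ∃ χ : Deck ρ →* GL (Fin n) ℂ, IsMonodromyRep ρ A χ ∧
    ∃ C : GL (Fin n) ℂ, ∀ k, M k = ((C⁻¹ * χ (σ k) * C : GL (Fin n) ℂ) : Mat n)
  localForm : ∀ k, HasLocalForm A (a k) (E k)
  formAtInfty : HasFormAtInfty A κ

end StandardForm

namespace StandardForm

open Filter Topology

/-! Suppose `κ_k - κ_{k+1} ≥ m - 1`. The local form at `a_j` gives `A` at most a simple pole there,
and the form at infinity gives `A_il = O(z ^ (κ_i - κ_l - 2))` for `i ≠ l`. If `l ≤ k < i`,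
monotonicity of `κ` makes `∏ (z - a_j) * A_il` an entire function of size `O(z⁻¹)`, hence zero by
Liouville (`coeff_eq_zero_of_gap`). So `A` is block triangular, and the lower components of `Y v`
satisfy a linear system of their own: if they vanish at one point, they vanish everywhere. The space
of such `v` is therefore the same at all points of the covering (`SolvesOnCover.lowerKernel_eq`), so
it is invariant under the monodromy. It is proper and nonzero because `Y` is invertible, which
contradicts irreducibility. -/

/-! ### The coefficient matrix near the singularities and near infinity. -/

theorem analyticAt_det {n : ℕ} {F : ℂ → Mat n} {z : ℂ}
    (hF : ∀ i j, AnalyticAt ℂ (fun ζ => F ζ i j) z) : AnalyticAt ℂ (fun ζ => (F ζ).det) z := by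
  simp only [Matrix.det_apply']
  exact Finset.analyticAt_fun_sum _ fun p _ =>
    analyticAt_const.mul (Finset.analyticAt_fun_prod _ fun i _ => hF _ _)

theorem analyticAt_mul_apply {n : ℕ} {F G : ℂ → Mat n} {z : ℂ}
    (hF : ∀ i j, AnalyticAt ℂ (fun ζ => F ζ i j) z)
    (hG : ∀ i j, AnalyticAt ℂ (fun ζ => G ζ i j) z) (i j : Fin n) :
    AnalyticAt ℂ (fun ζ => (F ζ * G ζ) i j) z := by
  simp only [Matrix.mul_apply]
  exact Finset.analyticAt_fun_sum _ fun p _ => (hF _ _).mul (hG _ _)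

theorem analyticAt_inv_apply {n : ℕ} {F : ℂ → Mat n} {z : ℂ}
    (hF : ∀ i j, AnalyticAt ℂ (fun ζ => F ζ i j) z) (hz : IsUnit (F z)) (i j : Fin n) :
    AnalyticAt ℂ (fun ζ => (F ζ)⁻¹ i j) z := by
  simp only [Matrix.inv_def, Ring.inverse_eq_inv', Matrix.smul_apply, smul_eq_mul,
    Matrix.adjugate_apply]
  refine (AnalyticAt.inv (analyticAt_det hF) ?_).mul (analyticAt_det fun p q => ?_)
  · exact ((Matrix.isUnit_iff_isUnit_det _).1 hz).ne_zero
  · by_cases hp : p = j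
    · subst hp
      simpa using analyticAt_const
    · simpa [Matrix.updateRow_ne hp] using hF p q

/-- The entrywise derivative of a matrix function. -/
noncomputable def matDeriv {n : ℕ} (F : ℂ → Mat n) (z : ℂ) : Mat n :=
  Matrix.of fun i j => deriv (fun ζ => F ζ i j) z

theorem hasDerivAt_exp_smul_apply {n : ℕ} (E : Mat n) (w : ℂ) (i j : Fin n) :
    HasDerivAt (fun u : ℂ => NormedSpace.exp (u • E) i j)
      ((E * NormedSpace.exp (w • E)) i j) w := by
  let _ : NormedRing (Mat n) := Matrix.linftyOpNormedRing
  let _ : NormedAlgebra ℂ (Mat n) := Matrix.linftyOpNormedAlgebra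
  have h := hasDerivAt_exp_smul_const' (𝕂 := ℂ) E w
  exact (hasDerivAt_pi.1 ((hasDerivAt_pi.1 h) i)) j

/-- Differentiating the solution `Z e^{wE}` in `w = log (z - a)` gives `(z - a) A = ((z - a) Z' + Z
E) Z⁻¹`, so `A` has at most a simple pole. -/
theorem HasLocalForm.sub_smul_analyticAt {n : ℕ} {A : ℂ → Mat n} {a : ℂ} {E : Mat n}
    (h : HasLocalForm A a E) :
    ∃ B : ℂ → Mat n, (∀ i j, AnalyticAt ℂ (fun z => B z i j) a) ∧
      ∀ᶠ z in 𝓝[≠] a, (z - a) • A z = B z := by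
  obtain ⟨ε, hε, Z, ⟨hZ, hZu⟩, hY⟩ := h
  have hsol := (hY fun w => Z (a + Complex.exp w) * NormedSpace.exp (w • E)).2
    ⟨1, fun w _ => by simp⟩
  have ha : a ∈ Metric.ball a ε := Metric.mem_ball_self hε
  refine ⟨fun z => ((z - a) • matDeriv Z z + Z z * E) * (Z z)⁻¹,
    analyticAt_mul_apply (fun i j => ?_)
      (analyticAt_inv_apply (fun i j => hZ i j a ha) (hZu a ha)), ?_⟩
  · simp only [Matrix.add_apply, Matrix.smul_apply, smul_eq_mul]
    refine AnalyticAt.add ?_ (analyticAt_mul_apply (fun i j => hZ i j a ha)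
      (G := fun _ => E) (fun i j => analyticAt_const) i j)
    exact (analyticAt_id.sub analyticAt_const).mul (hZ i j a ha).deriv
  · filter_upwards [self_mem_nhdsWithin, nhdsWithin_le_nhds (Metric.ball_mem_nhds a hε)]
      with z hza hz
    have hza' : z - a ≠ 0 := sub_ne_zero.2 hza
    obtain ⟨w, hw⟩ : ∃ w, Complex.exp w = z - a := ⟨_, Complex.exp_log hza'⟩
    have hzw : a + Complex.exp w = z := by rw [hw]; ring
    have hwm : w ∈ logHalfPlane ε := by
      have h1 : Real.exp w.re < ε := by
        rw [← Complex.norm_exp, hw, ← dist_eq_norm]; exact hz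
      exact (Real.lt_log_iff_exp_lt hε).2 h1
    obtain ⟨-, hd⟩ := hsol w hwm
    have key : logPullback A a w * (Z z * NormedSpace.exp (w • E)) =
        ((z - a) • matDeriv Z z + Z z * E) * NormedSpace.exp (w • E) := by
      ext i j
      have h1 := hd i j
      dsimp only at h1
      rw [hzw] at h1
      refine h1.unique ?_
      simp only [Matrix.mul_apply (M := Z _)]
      have h2 : HasDerivAt (fun u => a + Complex.exp u) (z - a) w := by
        rw [← hw]; exact (Complex.hasDerivAt_exp w).const_add a
      have h3 : ∀ l, HasDerivAt (fun u => Z (a + Complex.exp u) i l)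
          (matDeriv Z z i l * (z - a)) w := fun l => by
        refine HasDerivAt.comp (h₂ := fun ζ => Z ζ i l) w ?_ h2
        rw [hzw]
        exact (hZ i l z hz).differentiableAt.hasDerivAt
      have h4 := HasDerivAt.fun_sum (u := Finset.univ) fun l _ =>
        (h3 l).mul (hasDerivAt_exp_smul_apply E w l j)
      refine h4.congr_deriv ?_
      rw [hzw, add_mul, Matrix.mul_assoc, Matrix.add_apply, Matrix.mul_apply, Matrix.mul_apply,
        ← Finset.sum_add_distrib]
      refine Finset.sum_congr rfl fun l _ => ?_
      simp only [Matrix.smul_apply, smul_eq_mul]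
      ring
    have hX : IsUnit (NormedSpace.exp (w • E)) := Matrix.isUnit_exp _
    -- The multivalued factor `e^{wE}` cancels, so the formula depends on `z` alone.
    have h5 : logPullback A a w * Z z = (z - a) • matDeriv Z z + Z z * E := by
      refine hX.mul_right_cancel ?_
      rw [← key, Matrix.mul_assoc]
    have hZd := (Matrix.isUnit_iff_isUnit_det _).1 (hZu z hz)
    rw [← h5, Matrix.mul_nonsing_inv_cancel_right _ _ hZd, logPullback, hzw, hw]

/-- With `D = diag(z ^ κ_i)`, the equation gives `A = D' D⁻¹ + D (W(1/z))' W(1/z)⁻¹ D⁻¹`. The first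
term is diagonal; in the second, conjugation by `D` contributes `z ^ (κ_i - κ_l)` and the chain rule
`-z⁻²`. -/
theorem HasFormAtInfty.entry_eq {n : ℕ} {A : ℂ → Mat n} {κ : Fin n → ℤ}
    (h : HasFormAtInfty A κ) :
    ∃ ε : ℝ, 0 < ε ∧ ∃ G : ℂ → Mat n, (∀ i j, AnalyticAt ℂ (fun z => G z i j) 0) ∧
      ∀ z ∈ nhdInfty ε, ∀ i l, i ≠ l → A z i l = z ^ (κ i - κ l - 2) * G z⁻¹ i l := by
  obtain ⟨ε, hε, W, ⟨hW, hWu⟩, hY⟩ := h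
  have hsol := (hY fun z => Matrix.diagonal (fun i => z ^ κ i) * W z⁻¹).2
    ⟨1, fun w _ => by simp⟩
  have h0 : (0 : ℂ) ∈ Metric.ball 0 ε := Metric.mem_ball_self hε
  refine ⟨ε, hε, fun u => -matDeriv W u * (W u)⁻¹,
    analyticAt_mul_apply (fun i j => (hW i j 0 h0).deriv.neg)
      (analyticAt_inv_apply (fun i j => hW i j 0 h0) (hWu 0 h0)), fun z hz i l hil => ?_⟩
  have hz1 : ε⁻¹ < ‖z‖ := hz
  have hz0 : z ≠ 0 := norm_pos_iff.1 ((inv_pos.2 hε).trans hz1)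
  have hzb : z⁻¹ ∈ Metric.ball (0 : ℂ) ε := by
    rw [mem_ball_zero_iff, norm_inv]
    exact inv_lt_of_inv_lt₀ hε hz1
  obtain ⟨-, hd⟩ := hsol z hz
  have key : A z * (Matrix.diagonal (fun i => z ^ κ i) * W z⁻¹) =
      Matrix.diagonal (fun i => (κ i : ℂ) * z ^ (κ i - 1)) * W z⁻¹ +
        Matrix.diagonal (fun i => z ^ κ i * -(z ^ 2)⁻¹) * matDeriv W z⁻¹ := by
    ext i j
    refine (hd i j).unique ?_
    simp only [Matrix.diagonal_mul, Matrix.add_apply]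
    have h1 := hasDerivAt_zpow (κ i) z (Or.inl hz0)
    have h2 : HasDerivAt (fun u => W u⁻¹ i j) (matDeriv W z⁻¹ i j * -(z ^ 2)⁻¹) z :=
      HasDerivAt.comp (h₂ := fun ζ => W ζ i j) z
        (hW i j _ hzb).differentiableAt.hasDerivAt (hasDerivAt_inv hz0)
    refine (h1.mul h2).congr_deriv ?_
    ring
  have hWd := (Matrix.isUnit_iff_isUnit_det _).1 (hWu _ hzb)
  have h3 : A z * Matrix.diagonal (fun i => z ^ κ i) =
      Matrix.diagonal (fun i => (κ i : ℂ) * z ^ (κ i - 1)) +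
        Matrix.diagonal (fun i => z ^ κ i * -(z ^ 2)⁻¹) * (matDeriv W z⁻¹ * (W z⁻¹)⁻¹) := by
    have := congrArg (· * (W z⁻¹)⁻¹) key
    simpa only [add_mul, Matrix.mul_assoc, Matrix.mul_nonsing_inv _ hWd, mul_one] using this
  have h4 := congrFun (congrFun h3 i) l
  rw [Matrix.mul_diagonal, Matrix.add_apply, Matrix.diagonal_apply_ne _ hil,
    Matrix.diagonal_mul, zero_add] at h4
  have h5 : z ^ κ l ≠ 0 := zpow_ne_zero _ hz0
  refine mul_right_cancel₀ h5 ?_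
  dsimp only
  rw [h4, neg_mul, Matrix.neg_apply, zpow_sub₀ hz0, zpow_sub₀ hz0]
  field_simp

/-! ### Vanishing of coefficients by Liouville's theorem. -/

/-- A function that agrees near each point, except perhaps at the point itself, with an analytic
function, agrees with an entire function. -/
theorem exists_entire_of_eventuallyEq {f : ℂ → ℂ}
    (hf : ∀ z, ∃ g : ℂ → ℂ, AnalyticAt ℂ g z ∧ f =ᶠ[𝓝[≠] z] g) :
    ∃ g : ℂ → ℂ, Differentiable ℂ g ∧ ∀ z, ContinuousAt f z → f z = g z := by
  have hlim : ∀ z (g : ℂ → ℂ), ContinuousAt g z → f =ᶠ[𝓝[≠] z] g →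
      limUnder (𝓝[≠] z) f = g z := fun z g hg h =>
    ((hg.tendsto.mono_left nhdsWithin_le_nhds).congr' h.symm).limUnder_eq
  -- Punctured limits replace the arbitrary values of `f` at removable points.
  refine ⟨fun z => limUnder (𝓝[≠] z) f, fun z => ?_, fun z hz => (hlim z f hz EventuallyEq.rfl).symm⟩
  obtain ⟨g, hg, hfg⟩ := hf z
  refine hg.differentiableAt.congr_of_eventuallyEq ?_
  have h1 : ∀ᶠ y in 𝓝 z, y ≠ z → f y = g y := eventually_nhdsWithin_iff.1 hfg
  filter_upwards [h1.eventually_nhds, hg.eventually_analyticAt] with y hy hyg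
  refine hlim y g hyg.continuousAt ?_
  by_cases hyz : y = z
  · rw [hyz]; exact hfg
  · have h2 : ∀ᶠ x in 𝓝 y, x ≠ z := isOpen_ne.mem_nhds hyz
    exact nhdsWithin_le_nhds (by filter_upwards [hy, h2] with x hx hx' using hx hx')

theorem coeff_eq_zero_of_gap {m n : ℕ} {a : Fin m → ℂ}
    {A : ℂ → Mat n} {E : Fin m → Mat n} {κ : Fin n → ℤ}
    (hA : MatAnalyticOn A (Set.range a)ᶜ) (hE : ∀ k, HasLocalForm A (a k) (E k))
    (hκ : HasFormAtInfty A κ) {i l : Fin n} (hil : i ≠ l) (hgap : (m : ℤ) - 1 ≤ κ l - κ i)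
    {z : ℂ} (hz : z ∉ Set.range a) : A z i l = 0 := by
  set f : ℂ → ℂ := fun z => (∏ k, (z - a k)) * A z i l with hf
  have hfan : ∀ z ∉ Set.range a, AnalyticAt ℂ f z := fun z hz =>
    (Finset.analyticAt_fun_prod _ fun k _ => analyticAt_id.sub analyticAt_const).mul
      (hA i l z hz)
  obtain ⟨g, hg, hfg⟩ := exists_entire_of_eventuallyEq (f := f) fun z => by
    by_cases hz : z ∈ Set.range a
    · obtain ⟨k, rfl⟩ := hz
      obtain ⟨B, hB, hAB⟩ := (hE k).sub_smul_analyticAt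
      refine ⟨fun z => (∏ j ∈ Finset.univ.erase k, (z - a j)) * B z i l,
        (Finset.analyticAt_fun_prod _ fun k _ => analyticAt_id.sub analyticAt_const).mul
          (hB i l), ?_⟩
      filter_upwards [hAB] with z hz
      rw [← hz, hf]
      dsimp only
      rw [← Finset.mul_prod_erase _ _ (Finset.mem_univ k), Matrix.smul_apply, smul_eq_mul]
      ring
    · exact ⟨f, hfan z hz, EventuallyEq.rfl⟩
  have hlim : Tendsto g (cocompact ℂ) (𝓝 0) := by
    obtain ⟨ε, hε, G, hG, hAG⟩ := hκ.entry_eq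
    -- The gap hypothesis says exactly that the total exponent of `z` is at most `-1`.
    obtain ⟨N, hN⟩ : ∃ N : ℕ, κ i - κ l - 2 + m = -((N + 1 : ℕ) : ℤ) :=
      ⟨(κ l - κ i + 1 - m).toNat, by push_cast; omega⟩
    have hH : Tendsto (fun u : ℂ => u ^ (N + 1) * ((∏ k, (1 - a k * u)) * G u i l)) (𝓝 0)
        (𝓝 0) := by
      have : ContinuousAt (fun u : ℂ => u ^ (N + 1) * ((∏ k, (1 - a k * u)) * G u i l)) 0 :=
        (continuousAt_id.pow _).mul (ContinuousAt.mul
          (Continuous.continuousAt (by fun_prop)) (hG i l).continuousAt)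
      simpa [ContinuousAt] using this
    refine (hH.comp (Filter.tendsto_inv₀_cobounded (α := ℂ))).mono_left
      Metric.cobounded_eq_cocompact.ge |>.congr' ?_
    have hbig : ∀ R : ℝ, ∀ᶠ z : ℂ in cocompact ℂ, R < ‖z‖ := fun R =>
      (tendsto_norm_cocompact_atTop (E := ℂ)).eventually_gt_atTop R
    have hoff : ∀ᶠ z : ℂ in cocompact ℂ, z ∉ Set.range a :=
      (Set.finite_range a).isCompact.compl_mem_cocompact
    filter_upwards [hbig ε⁻¹, hoff] with z hz hza
    have hz0 : z ≠ 0 := norm_pos_iff.1 ((inv_pos.2 hε).trans hz)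
    rw [← hfg z (hfan z hza).continuousAt, hf]
    dsimp only [Function.comp]
    rw [hAG z hz i l hil]
    have h1 : ∏ k, (z - a k) = z ^ m * ∏ k, (1 - a k * z⁻¹) := by
      rw [← Fin.prod_const, ← Finset.prod_mul_distrib]
      refine Finset.prod_congr rfl fun k _ => ?_
      field_simp
    have h2 : z ^ (κ i - κ l - 2) * z ^ m = z⁻¹ ^ (N + 1) := by
      rw [← zpow_natCast z m, ← zpow_add₀ hz0, hN, zpow_neg, zpow_natCast, inv_pow]
    rw [h1, ← h2]
    ring
  have h0 : f z = 0 := by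
    rw [hfg z (hfan z hz).continuousAt, hg.apply_eq_of_tendsto_cocompact z hlim]
  refine (mul_eq_zero.1 h0).resolve_left (Finset.prod_ne_zero_iff.2 fun k _ => ?_)
  exact sub_ne_zero.2 fun h => hz ⟨k, h.symm⟩

/-! ### The constant subspace defined by a block triangular system. -/

/-- The vectors `v` for which the entries of `Y v` with index larger than `k` vanish. -/
def lowerKernel {n : ℕ} (k : ℕ) (Y : Mat n) : Submodule ℂ (Fin n → ℂ) where
  carrier := {v | ∀ i : Fin n, k < i → Y.mulVec v i = 0}
  add_mem' := fun {v w} hv hw i hi => by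
    rw [Matrix.mulVec_add, Pi.add_apply, hv i hi, hw i hi, add_zero]
  zero_mem' := fun i _ => by rw [Matrix.mulVec_zero, Pi.zero_apply]
  smul_mem' := fun c v hv i hi => by
    rw [Matrix.mulVec_smul, Pi.smul_apply, hv i hi, smul_zero]

/-- `A` is block upper triangular with respect to the splitting of the indices after `k`. -/
def BlockTriangular {n : ℕ} (k : ℕ) (A : Mat n) : Prop :=
  ∀ i l : Fin n, k < i → (l : ℕ) ≤ k → A i l = 0

/-- Along the segment from `z` to `w`, the lower part of `F v` solves a homogeneous linear equation
with zero initial value, so Grönwall's inequality makes it vanish. Equality follows by exchanging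
`z` and `w`. -/
theorem SolvesOn.lowerKernel_le {n k : ℕ} {A F : ℂ → Mat n} {U : Set ℂ} (hU : Convex ℝ U)
    (hA : MatAnalyticOn A U) (hk : ∀ z ∈ U, BlockTriangular k (A z)) (hF : SolvesOn A U F)
    {z w : ℂ} (hz : z ∈ U) (hw : w ∈ U) : lowerKernel k (F z) ≤ lowerKernel k (F w) := by
  intro v hv
  set p : ℝ → ℂ := fun s => z + s * (w - z) with hp
  have hpU : ∀ s ∈ Set.Icc (0 : ℝ) 1, p s ∈ U := fun s hs => by
    have := hU.add_smul_sub_mem hz hw hs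
    simpa [hp, Complex.real_smul] using this
  have hpd : ∀ s, HasDerivAt p (w - z) s := fun s => by
    have := ((Complex.ofRealCLM.hasDerivAt (x := s)).mul_const (w - z)).const_add z
    simpa [hp] using this
  have hpc : Continuous p := by fun_prop
  -- Padding the upper components with zeros keeps the lower system `u' = B u` in `Fin n → ℂ`.
  set u : ℂ → Fin n → ℂ := fun ζ i => if k < (i : ℕ) then (F ζ).mulVec v i else 0 with hu
  set B : ℂ → Mat n := fun ζ => Matrix.of fun i l => if k < (i : ℕ) then A ζ i l else 0 with hB
  have hud : ∀ ζ ∈ U, HasDerivAt u ((B ζ).mulVec (u ζ)) ζ := fun ζ hζ => by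
    refine hasDerivAt_pi.2 fun i => ?_
    by_cases hi : k < (i : ℕ)
    · simp only [hu, hi, if_true, Matrix.mulVec, dotProduct]
      have h := HasDerivAt.fun_sum (u := Finset.univ) fun j _ =>
        ((hF ζ hζ).2 i j).mul_const (v j)
      refine h.congr_deriv ?_
      have h1 : ∑ j, (A ζ * F ζ) i j * v j = (A ζ).mulVec ((F ζ).mulVec v) i := by
        rw [Matrix.mulVec_mulVec]; rfl
      rw [h1]
      change ∑ l, A ζ i l * (F ζ).mulVec v l = _
      refine Finset.sum_congr rfl fun l _ => ?_
      by_cases hl : k < (l : ℕ)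
      · simp [hB, hi, hl, Matrix.mulVec, dotProduct]
      · simp [hl, hk ζ hζ i l hi (not_lt.1 hl)]
    · simpa [hu, hB, hi, Matrix.mulVec, dotProduct] using hasDerivAt_const ζ (0 : ℂ)
  have hderiv : ∀ s ∈ Set.Icc (0 : ℝ) 1,
      HasDerivAt (fun s => u (p s)) ((w - z) • (B (p s)).mulVec (u (p s))) s := fun s hs =>
    HasDerivAt.scomp s (hud (p s) (hpU s hs)) (hpd s)
  obtain ⟨K, hK⟩ : ∃ K : ℝ, ∀ s ∈ Set.Icc (0 : ℝ) 1, ∑ i, ∑ l, ‖A (p s) i l‖ ≤ K := by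
    have hc : ContinuousOn (fun s => ∑ i, ∑ l, ‖A (p s) i l‖) (Set.Icc (0 : ℝ) 1) :=
      continuousOn_finsetSum _ fun i _ => continuousOn_finsetSum _ fun l _ =>
        (ContinuousOn.comp (g := fun ζ => A ζ i l) (hA i l).continuousOn hpc.continuousOn
          hpU).norm
    obtain ⟨K, hK⟩ := isCompact_Icc.bddAbove_image hc
    exact ⟨K, fun s hs => hK ⟨s, hs, rfl⟩⟩
  have hbound : ∀ s ∈ Set.Icc (0 : ℝ) 1,
      ‖(w - z) • (B (p s)).mulVec (u (p s))‖ ≤ ‖w - z‖ * K * ‖u (p s)‖ := fun s hs => by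
    have hK0 : 0 ≤ K := (Finset.sum_nonneg fun i _ => Finset.sum_nonneg fun l _ =>
      norm_nonneg _).trans (hK s hs)
    rw [norm_smul, mul_assoc]
    refine mul_le_mul_of_nonneg_left ?_ (norm_nonneg _)
    refine (pi_norm_le_iff_of_nonneg (by positivity)).2 fun i => ?_
    calc ‖(B (p s)).mulVec (u (p s)) i‖ ≤ ∑ l, ‖A (p s) i l‖ * ‖u (p s)‖ := by
          refine norm_sum_le_of_le Finset.univ (f := fun l => B (p s) i l * u (p s) l)
            fun l _ => ?_
          rw [norm_mul]
          refine mul_le_mul ?_ (norm_le_pi_norm _ l) (norm_nonneg _) (norm_nonneg _)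
          simp only [hB, Matrix.of_apply]
          split_ifs
          · exact le_rfl
          · simp
      _ = (∑ l, ‖A (p s) i l‖) * ‖u (p s)‖ := (Finset.sum_mul _ _ _).symm
      _ ≤ K * ‖u (p s)‖ := by
          refine mul_le_mul_of_nonneg_right (le_trans ?_ (hK s hs)) (norm_nonneg _)
          exact Finset.single_le_sum (f := fun i => ∑ l, ‖A (p s) i l‖)
            (fun i _ => Finset.sum_nonneg fun l _ => norm_nonneg _) (Finset.mem_univ i)
  have h0 : u (p 0) = 0 := by
    ext i
    have : p 0 = z := by simp [hp]
    rw [this]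
    by_cases hi : k < (i : ℕ)
    · simp [hu, hi, hv i hi]
    · simp [hu, hi]
  have h1 := eq_zero_of_abs_deriv_le_mul_abs_self_of_eq_zero_right
    (fun s hs => (hderiv s hs).continuousAt.continuousWithinAt)
    (fun s hs => (hderiv s (Set.Ico_subset_Icc_self hs)).hasDerivWithinAt) h0
    (fun s hs => hbound s (Set.Ico_subset_Icc_self hs)) 1 (by simp)
  intro i hi
  have h2 := congrFun h1 i
  have : p 1 = w := by simp [hp]
  simpa [this, hu, hi] using h2

/-! ### Constancy of the subspace on the covering surface. -/

section Cover

variable {m n : ℕ} {a : Fin m → ℂ} {X : Type*} [TopologicalSpace X]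
  {ρ : X → PuncturedSphere a} {A : ℂ → Mat n} {Y : X → Mat n}

theorem PuncturedSphere.coe_notMem_range {p : PuncturedSphere a} {z : ℂ}
    (h : p.1 = (z : OnePoint ℂ)) : z ∉ Set.range a := by
  rintro ⟨k, rfl⟩
  exact p.2 k h

theorem exists_coe_of_ne_infty {p : OnePoint ℂ} (h : p ≠ OnePoint.infty) :
    ∃ z : ℂ, p = (z : OnePoint ℂ) := by
  obtain ⟨z, rfl⟩ := OnePoint.ne_infty_iff_exists.1 h
  exact ⟨z, rfl⟩

theorem isOpen_compl_marked : IsOpen {p : OnePoint ℂ | ∀ k, p ≠ (a k : OnePoint ℂ)} := by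
  have : {p : OnePoint ℂ | ∀ k, p ≠ (a k : OnePoint ℂ)} =
      (Set.range fun k => (a k : OnePoint ℂ))ᶜ := by
    ext p
    simp [eq_comm]
  rw [this]
  exact (Set.finite_range _).isClosed.isOpen_compl

theorem PuncturedSphere.isOpenEmbedding_val :
    IsOpenEmbedding (fun p : PuncturedSphere a => p.1) :=
  (isOpen_compl_marked (a := a)).isOpenEmbedding_subtypeVal

/-- The covering map is open, so otherwise infinity would be an isolated point of the sphere. -/
theorem frequently_ne_infty (hρ : IsCoveringMap ρ) (x : X) :
    ∃ᶠ x' in 𝓝 x, (ρ x').1 ≠ OnePoint.infty := by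
  intro h
  simp only [not_not] at h
  obtain ⟨O, hO, hOo, hxO⟩ := eventually_nhds_iff.1 h
  have h1 : IsOpen ((fun x => (ρ x).1) '' O) :=
    (PuncturedSphere.isOpenEmbedding_val.isOpenMap.comp hρ.isOpenMap) O hOo
  have h2 : (fun x => (ρ x).1) '' O = {OnePoint.infty} := by
    ext p
    constructor
    · rintro ⟨y, hy, rfl⟩
      exact hO y hy
    · rintro rfl
      exact ⟨x, hxO, hO x hxO⟩
  rw [h2] at h1
  have h3 : (𝓝[≠] (OnePoint.infty : OnePoint ℂ)).NeBot := OnePoint.nhdsNE_infty_neBot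
  exact h3.ne (isOpen_singleton_iff_punctured_nhds _ |>.1 h1)

theorem SolvesOnCover.isUnit (hY : SolvesOnCover ρ A Y) {x : X}
    (hx : (ρ x).1 ≠ OnePoint.infty) : IsUnit (Y x) := by
  obtain ⟨z, hz⟩ := exists_coe_of_ne_infty hx
  obtain ⟨U, -, hzU, F, hF, hYF⟩ := hY x z hz
  rw [hYF.self_of_nhds z hz]
  exact (hF z hzU).1

variable {k : ℕ}

theorem SolvesOnCover.eventually_lowerKernel_eq (hρ : Continuous ρ) (hY : SolvesOnCover ρ A Y)
    (hA : MatAnalyticOn A (Set.range a)ᶜ) (hk : ∀ z ∉ Set.range a, BlockTriangular k (A z))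
    {x : X} (hx : (ρ x).1 ≠ OnePoint.infty) :
    ∀ᶠ x' in 𝓝 x, lowerKernel k (Y x') = lowerKernel k (Y x) := by
  obtain ⟨z, hz⟩ := exists_coe_of_ne_infty hx
  obtain ⟨U, hU, hzU, F, hF, hYF⟩ := hY x z hz
  have hUa : U ∩ (Set.range a)ᶜ ∈ 𝓝 z :=
    inter_mem (hU.mem_nhds hzU) ((Set.finite_range a).isClosed.isOpen_compl.mem_nhds
      (PuncturedSphere.coe_notMem_range hz))
  obtain ⟨r, hr, hrU⟩ := Metric.mem_nhds_iff.1 hUa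
  have hFr : SolvesOn A (Metric.ball z r) F := fun ζ hζ => hF ζ (hrU hζ).1
  have hle : ∀ {ζ ω : ℂ}, ζ ∈ Metric.ball z r → ω ∈ Metric.ball z r →
      lowerKernel k (F ζ) ≤ lowerKernel k (F ω) := fun hζ hω =>
    hFr.lowerKernel_le (convex_ball z r) (fun i j ζ hζ => hA i j ζ (hrU hζ).2)
      (fun ζ hζ => hk ζ (hrU hζ).2) hζ hω
  have hnear : ∀ᶠ x' in 𝓝 x, (ρ x').1 ∈ OnePoint.some '' Metric.ball z r := by
    have hc : Continuous fun x => (ρ x).1 := continuous_subtype_val.comp hρ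
    refine hc.continuousAt.eventually_mem
      ((OnePoint.isOpenEmbedding_coe.isOpenMap _ Metric.isOpen_ball).mem_nhds ?_)
    exact ⟨z, Metric.mem_ball_self hr, hz.symm⟩
  filter_upwards [hYF, hnear] with x' hx' ⟨ζ, hζ, hζx⟩
  rw [hx' ζ hζx.symm, hYF.self_of_nhds z hz]
  exact le_antisymm (hle hζ (Metric.mem_ball_self hr)) (hle (Metric.mem_ball_self hr) hζ)

theorem isPreconnected_norm_gt {R : ℝ} (hR : 0 < R) : IsPreconnected {z : ℂ | R < ‖z‖} := by
  have h : {z : ℂ | R < ‖z‖} = Complex.exp '' {w | Real.log R < w.re} := by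
    ext z
    constructor
    · intro hz
      have hz0 : z ≠ 0 := norm_pos_iff.1 (hR.trans hz)
      refine ⟨Complex.log z, ?_, Complex.exp_log hz0⟩
      rw [Set.mem_ofPred_eq, Complex.log_re]
      exact Real.log_lt_log hR hz
    · rintro ⟨w, hw, rfl⟩
      rw [Set.mem_ofPred_eq, Complex.norm_exp]
      exact (Real.log_lt_iff_lt_exp hR).1 hw
  rw [h]
  exact (convex_halfSpace_re_gt _).isPreconnected.image _ Complex.continuous_exp.continuousOn

/-- Near any point of the covering, also one above infinity, the subspace `lowerKernel k (Y x)` is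
the same for all `x` that do not lie above infinity. -/
theorem SolvesOnCover.exists_eventually_lowerKernel_eq (hρ : IsCoveringMap ρ)
    (hY : SolvesOnCover ρ A Y) (hA : MatAnalyticOn A (Set.range a)ᶜ)
    (hk : ∀ z ∉ Set.range a, BlockTriangular k (A z)) (x : X) :
    ∃ V, ∀ᶠ x' in 𝓝 x, (ρ x').1 ≠ OnePoint.infty → lowerKernel k (Y x') = V := by
  have hloc := fun (x : X) (hx : (ρ x).1 ≠ OnePoint.infty) =>
    hY.eventually_lowerKernel_eq hρ.continuous hA hk hx
  by_cases hx : (ρ x).1 = OnePoint.infty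
  swap
  · exact ⟨_, (hloc x hx).mono fun x' h _ => h⟩
  -- Above infinity `Y` is not controlled, so the connected region `|z| > R` is lifted by a local
  -- inverse of the covering, and local constancy is propagated along the lift.
  obtain ⟨e, hxe, rfl⟩ := hρ.isLocalHomeomorph x
  have hT : (fun p : PuncturedSphere a => p.1) '' e.target ∈ 𝓝 (OnePoint.infty : OnePoint ℂ) := by
    refine (PuncturedSphere.isOpenEmbedding_val.isOpenMap _ e.open_target).mem_nhds ?_
    exact ⟨e x, e.map_source hxe, hx⟩
  obtain ⟨R, hR, hRT⟩ : ∃ R : ℝ, 0 < R ∧ ∀ z : ℂ, R < ‖z‖ →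
      ∃ p ∈ e.target, p.1 = (z : OnePoint ℂ) := by
    have h1 := OnePoint.tendsto_coe_infty (X := ℂ) hT
    rw [Filter.coclosedCompact_eq_cocompact, ← Metric.cobounded_eq_cocompact] at h1
    obtain ⟨R, -, hR⟩ := (Metric.hasBasis_cobounded_compl_closedBall (0 : ℂ)).mem_iff.1 h1
    -- The maximum ensures a positive radius, which `isPreconnected_norm_gt` needs.
    refine ⟨max R 1, by positivity, fun z hz => ?_⟩
    have : z ∈ (Metric.closedBall (0 : ℂ) R)ᶜ := by
      simpa using (le_max_left _ _).trans_lt hz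
    exact hR this
  have : Nonempty (PuncturedSphere a) := ⟨e x⟩
  choose! q hqt hqz using hRT
  have hq_cont : ∀ z : ℂ, R < ‖z‖ → ContinuousWithinAt q {z : ℂ | R < ‖z‖} z := fun z hz => by
    refine PuncturedSphere.isOpenEmbedding_val.isInducing.continuousWithinAt_iff.2 ?_
    refine (OnePoint.continuous_coe.continuousWithinAt (s := {z : ℂ | R < ‖z‖})
      (x := z)).congr (fun y hy => hqz y hy) (hqz z hz)
  have hfin : ∀ z : ℂ, R < ‖z‖ → (e (e.symm (q z))).1 ≠ OnePoint.infty := fun z hz => by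
    rw [e.right_inv (hqt z hz), hqz z hz]
    exact OnePoint.coe_ne_infty z
  have hconst : ∀ {z w : ℂ}, R < ‖z‖ → R < ‖w‖ →
      lowerKernel k (Y (e.symm (q z))) = lowerKernel k (Y (e.symm (q w))) := by
    intro z w hz hw
    refine (isPreconnected_norm_gt hR).induction₂ (fun z w =>
      lowerKernel k (Y (e.symm (q z))) = lowerKernel k (Y (e.symm (q w)))) (fun z hz => ?_)
      (fun _ _ _ _ _ _ => Eq.trans) (fun _ _ _ _ => Eq.symm) hz hw
    have hc : ContinuousWithinAt (fun z => e.symm (q z)) {z : ℂ | R < ‖z‖} z :=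
      (e.continuousAt_symm (hqt z hz)).comp_continuousWithinAt (hq_cont z hz)
    exact (hc.eventually (hloc _ (hfin z hz))).mono fun _ h => h.symm
  have hR1 : R < ‖((R + 1 : ℝ) : ℂ)‖ := by
    rw [Complex.norm_real, Real.norm_of_nonneg (by positivity)]; linarith
  refine ⟨lowerKernel k (Y (e.symm (q (R + 1 : ℝ)))), ?_⟩
  have hnear : ∀ᶠ x' in 𝓝 x, ∀ z : ℂ, (e x').1 = (z : OnePoint ℂ) → R < ‖z‖ := by
    -- This set contains infinity vacuously; its complement is a closed disk.
    have hO : IsOpen {p : OnePoint ℂ | ∀ z : ℂ, p = (z : OnePoint ℂ) → R < ‖z‖} := by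
      rw [OnePoint.isOpen_def]
      constructor
      · intro _
        have : (OnePoint.some ⁻¹' {p : OnePoint ℂ | ∀ z : ℂ, p = (z : OnePoint ℂ) → R < ‖z‖})ᶜ =
            Metric.closedBall (0 : ℂ) R := by
          ext z; simp
        rw [this]
        exact isCompact_closedBall 0 R
      · have : OnePoint.some ⁻¹' {p : OnePoint ℂ | ∀ z : ℂ, p = (z : OnePoint ℂ) → R < ‖z‖} =
            {z : ℂ | R < ‖z‖} := by
          ext z; simp
        rw [this]
        exact isOpen_lt continuous_const continuous_norm
    have hc : Continuous fun x => (e x).1 := continuous_subtype_val.comp hρ.continuous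
    refine hc.continuousAt.eventually_mem (hO.mem_nhds fun z hz => ?_)
    exact absurd (hz.symm.trans hx) (OnePoint.coe_ne_infty z)
  filter_upwards [hnear, e.open_source.mem_nhds hxe] with x' hx' hs hfin'
  obtain ⟨z, hz⟩ := exists_coe_of_ne_infty hfin'
  have hqe : q z = e x' := Subtype.ext ((hqz z (hx' z hz)).trans hz.symm)
  rw [← hconst (hx' z hz) hR1, hqe, e.left_inv hs]

theorem SolvesOnCover.lowerKernel_eq [PreconnectedSpace X] (hρ : IsCoveringMap ρ)
    (hY : SolvesOnCover ρ A Y) (hA : MatAnalyticOn A (Set.range a)ᶜ)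
    (hk : ∀ z ∉ Set.range a, BlockTriangular k (A z)) {x y : X}
    (hx : (ρ x).1 ≠ OnePoint.infty) (hy : (ρ y).1 ≠ OnePoint.infty) :
    lowerKernel k (Y x) = lowerKernel k (Y y) := by
  choose V hV using hY.exists_eventually_lowerKernel_eq hρ hA hk
  have hxy : V x = V y := by
    refine PreconnectedSpace.induction₂' (fun x y => V x = V y) (fun x => ?_)
      ⟨fun _ _ _ => Eq.trans⟩ x y
    -- Both values are compared at a point close to `y` that is not above infinity.
    have h1 : ∀ᶠ y in 𝓝 x, V x = V y := by
      filter_upwards [(hV x).eventually_nhds] with y hy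
      obtain ⟨x', hne, h1, h2⟩ := ((frequently_ne_infty hρ y).and_eventually
        (hy.and (hV y))).exists
      exact (h1 hne).symm.trans (h2 hne)
    exact h1.mono fun y h => ⟨h, h.symm⟩
  rw [(hV x).self_of_nhds hx, (hV y).self_of_nhds hy, hxy]

/-! ### Reducibility of the monodromy, and the conclusion. -/

theorem not_irreducibleMonodromy (hρ : IsUniversalCovering ρ)
    (hA : MatAnalyticOn A (Set.range a)ᶜ) (hkn : k + 1 < n)
    (hk : ∀ z ∉ Set.range a, BlockTriangular k (A z)) : ¬ IrreducibleMonodromy ρ A := by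
  rintro ⟨χ, ⟨Y, hY, hχ⟩, hirr⟩
  have := hρ.simplyConnected
  obtain ⟨x₁⟩ : Nonempty X := inferInstance
  obtain ⟨x, hx⟩ := (frequently_ne_infty hρ.covering x₁).exists
  have hdet := (Matrix.isUnit_iff_isUnit_det _).1 (hY.isUnit hx)
  have hinv : ∀ w, (Y x).mulVec ((Y x)⁻¹.mulVec w) = w := fun w => by
    rw [Matrix.mulVec_mulVec, Matrix.mul_nonsing_inv _ hdet, Matrix.one_mulVec]
  -- Invariance: `Y(σ x) χ(σ) v = Y(x) v`, and the subspaces at `x` and `σ x` coincide.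
  rcases hirr (lowerKernel k (Y x)) fun σ v hv => by
    have hσx : (ρ ((σ : X ≃ₜ X) x)).1 ≠ OnePoint.infty := by rwa [σ.2 x]
    rw [hY.lowerKernel_eq hρ.covering hA hk hx hσx]
    intro i hi
    rw [Matrix.mulVec_mulVec, ← hχ σ x hx]
    exact hv i hi with h | h
  -- The subspace contains `Y⁻¹ e_0`, so it is not zero; it omits `Y⁻¹ e_{k+1}`, so it is not
  -- everything.
  · let i₀ : Fin n := ⟨0, by omega⟩
    have hmem : (Y x)⁻¹.mulVec (Pi.single i₀ 1) ∈ lowerKernel k (Y x) := fun i hi => by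
      rw [hinv]
      refine Pi.single_eq_of_ne (fun h => ?_) _
      rw [h] at hi
      exact absurd hi (Nat.not_lt_zero k)
    rw [h, Submodule.mem_bot] at hmem
    have h1 := congrFun (hinv (Pi.single i₀ 1)) i₀
    rw [hmem, Matrix.mulVec_zero] at h1
    simp at h1
  · let i₁ : Fin n := ⟨k + 1, hkn⟩
    have hmem : (Y x)⁻¹.mulVec (Pi.single i₁ 1) ∈ lowerKernel k (Y x) := h ▸ Submodule.mem_top
    have h1 := hmem i₁ (Nat.lt_succ_self k)
    rw [hinv] at h1
    simp at h1

end Cover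

end StandardForm

theorem theorem5p2 {m n : ℕ} (a : Fin m → ℂ) (ha : Function.Injective a)
    {X : Type*} [TopologicalSpace X] (ρ : X → StandardForm.PuncturedSphere a)
    (hρ : StandardForm.IsUniversalCovering ρ)
    (Γ : ℝ → ℂ) (t : Fin m → ℝ) (hΓ : StandardForm.IsCurveThrough a Γ t)
    (x₀ : X) (σ : Fin m → StandardForm.Deck ρ)
    (hσ : StandardForm.IsStandardDeck ρ Γ t x₀ σ)
    (A : ℂ → StandardForm.Mat n) (M E : Fin m → StandardForm.Mat n) (κ : Fin n → ℤ)
    (hA : StandardForm.IsStandardForm ρ σ A M E κ)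
    (hirr : StandardForm.IrreducibleMonodromy ρ A) :
    ∀ (k : ℕ) (hk : k + 1 < n),
      κ ⟨k, Nat.lt_of_succ_lt hk⟩ - κ ⟨k + 1, hk⟩ ≤ (m : ℤ) - 2 := by
  intro k hk
  by_contra! hgap
  refine StandardForm.not_irreducibleMonodromy hρ hA.analytic hk (fun z hz i l hi hl => ?_) hirr
  -- For `l ≤ k < i`, the gap `κ_l - κ_i` is at least the gap between the neighbours `k` and `k +
  -- 1`.
  have h1 : κ i ≤ κ ⟨k + 1, hk⟩ := hA.ordered (Fin.mk_le_of_le_val hi)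
  have h2 : κ ⟨k, Nat.lt_of_succ_lt hk⟩ ≤ κ l := hA.ordered (Fin.le_def.2 hl)
  refine StandardForm.coeff_eq_zero_of_gap hA.analytic hA.localForm hA.formAtInfty
    (fun h => ?_) (by omega) hz
  rw [h] at hi
  omega
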